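/- Let $B\ge 0$, let $i_0>0$ satisfy $\frac{B}{4i_0}<\frac12$, and for integers $i\ge1$ put $p_i=\frac12-\frac{B}{4i}$ if $i>i_0$ and $p_i=\frac12$ if $i\le i_0$; let $q_i=1-p_i$ and $f_i(s)=\frac{p_i}{1-q_is}$ for $s\in[0,1]$. Let $(Z_n)_{n\ge0}$ be a process with values in $\{0,1,2,\dots\}$ such that $Z_0=0$ and $$E\left(s^{Z_n}\,\middle|\,Z_0,\dots,Z_{n-1}\right)=[f_n(s)]^{1+Z_{n-1}},\qquad n\ge1,\ s\in[0,1],$$ that is, a branching process in varying environment with geometric offspring laws and exactly one immigrant in each generation. Call $n\ge0$ a regeneration time if $Z_n=0$. (i) If $B\ge1$, then almost surely $(Z_n)$ has at most finitely many regeneration times. (ii) If $B<1$, then almost surely $(Z_n)$ has infinitely many regeneration times. (iii) In particular, let $B=1$. Then every process $(Y_n)_{n\ge0}$ with values in $\{0,1,2,\dots\}$ such that $Y_0=1$ and $E(s^{Y_n}\mid Y_0,\dots,Y_{n-1})=[f_n(s)]^{Y_{n-1}}$ for $n\ge1$, $s\in[0,1]$ (the corresponding process without immigration) dies out almost surely,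 i.e. almost surely $Y_n=0$ for some $n$; nevertheless $(Z_n)$ has almost surely at most finitely many regeneration times. -/

import Mathlib

open MeasureTheory

/-- The probability generating function `f(s) = p / (1 - q s)`, `q = 1 - p`, of the geometric
offspring law `k ↦ p q ^ k` on `{0, 1, 2, …}`. -/
noncomputable def geomPGF (p s : ℝ) : ℝ := p / (1 - (1 - p) * s)

/-- The σ-algebra `σ(X 0, …, X n)` generated by the first `n + 1` members of a sequence of
`ℕ`-valued functions. -/
abbrev pastSigma {Ω : Type*} (X : ℕ → Ω → ℕ) (n : ℕ) : MeasurableSpace Ω :=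
  MeasurableSpace.comap (fun ω (k : Fin (n + 1)) => X k ω) inferInstance

/-- `Z` is a branching process in the varying environment `p 1, p 2, …` with geometric offspring
laws and exactly one immigrant in each generation: `Z 0 = 0` and, for each generation `n + 1 ≥ 1`,
`E (s ^ Z (n + 1) | Z 0, …, Z n) = f_{n + 1}(s) ^ (1 + Z n)` for `s ∈ [0, 1]`. -/
structure IsBranchingWithImmigration {Ω : Type*} [MeasurableSpace Ω] (P : Measure Ω)
    (p : ℕ → ℝ) (Z : ℕ → Ω → ℕ) : Prop where
  measurable : ∀ n, Measurable (Z n)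
  init : ∀ᵐ ω ∂P, Z 0 ω = 0
  step : ∀ n : ℕ, ∀ s ∈ Set.Icc (0 : ℝ) 1,
    P[fun ω => s ^ Z (n + 1) ω | pastSigma Z n]
      =ᵐ[P] fun ω => geomPGF (p (n + 1)) s ^ (1 + Z n ω)

/-- `Y` is the branching process in the varying environment `p 1, p 2, …` with geometric offspring
laws, without immigration, started from one individual: `Y 0 = 1` and, for each generation
`n + 1 ≥ 1`, `E (s ^ Y (n + 1) | Y 0, …, Y n) = f_{n + 1}(s) ^ Y n` for `s ∈ [0, 1]`. -/
structure IsBranching {Ω : Type*} [MeasurableSpace Ω] (P : Measure Ω)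
    (p : ℕ → ℝ) (Y : ℕ → Ω → ℕ) : Prop where
  measurable : ∀ n, Measurable (Y n)
  init : ∀ᵐ ω ∂P, Y 0 ω = 1
  step : ∀ n : ℕ, ∀ s ∈ Set.Icc (0 : ℝ) 1,
    P[fun ω => s ^ Y (n + 1) ω | pastSigma Y n]
      =ᵐ[P] fun ω => geomPGF (p (n + 1)) s ^ Y n ω

/-- The random set `{n ≥ 0 : Z n = 0}` of regeneration times. -/
def regenerationTimes {Ω : Type*} (Z : ℕ → Ω → ℕ) (ω : Ω) : Set ℕ := {n | Z n ω = 0}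

/-- The near-critical environment `p i = 1/2 - B / (4 i)` for `i > i₀` and `p i = 1/2` for
`i ≤ i₀` (only the values at `i ≥ 1` are used). -/
noncomputable def nearCritical (B i₀ : ℝ) (i : ℕ) : ℝ :=
  open Classical in if i₀ < (i : ℝ) then 1 / 2 - B / (4 * (i : ℝ)) else 1 / 2

/-!
In the coordinate `y = 1 / (1 - s)` the generating function `p / (1 - q s)` is the affine map
`y ↦ 1 + (p / q) y`, so the iterated generating functions are explicit. With the weights
`A n = ∏_{i ≤ n} p i / q i` they give, for every event `G` of the past up to time `k`,
`P (G ∩ {Z n = 0}) = A n / (A k + ⋯ + A n) * E (1_G (1 - A k / (A k + ⋯ + A n)) ^ Z k)`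
(`IsBranchingWithImmigration.measureReal_inter_zero_eq`). Regenerations therefore form a renewal
process with `u m n = P (Z n = 0 | Z m = 0) = A n / (A m + ⋯ + A n)` (`regenProb`), and the expected
number of them in a window decomposes according to the first one
(`sum_measureReal_inter_zero_eq`). In the near-critical environment `A n` is of the order
`n ^ (-B)`.

* For `B < 1` one has `u 0 n ≥ (1 - B) / (n + 1)` and `u m n ≤ 1 / (n - m + 1)`. Given any past, the
  expected number of regenerations up to `M` is thus asymptotically at least `(1 - B) log M`, and at
  most about `log M` times the probability that there is one; hence this probability is at least
  `1 - B`, and Lévy's zero-one law gives infinitely many regenerations.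
* For `B ≥ 1` the sequence `(2 n + 1) A n` is eventually nonincreasing, so `u 0 n` is at most of the
  order `1 / (n log n)`. At `B = 1` these probabilities are not summable, but regenerations come in
  clusters: a regeneration at `m` is followed by at least of the order of `log m` expected ones in
  `[m, 2 m]`. So a dyadic block `[2 ^ j, 2 ^ (j + 1)]` contains a regeneration with probability at
  most of the order `1 / j ^ 2`, and the Borel–Cantelli lemma applies.
* Without immigration `P (Y n = 0) = 1 - 1 / (A 0 + ⋯ + A n)`, which tends to `1` when `B = 1` since
  then `A n ≥ 1 / (2 n + 1)`.
-/

open MeasureTheory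

/-! ### Iterated generating functions -/

/-- The weight `A n = ∏_{i = 1}^n p i / (1 - p i)`, the reciprocal of the mean of the `n`-th
generation of the branching process without immigration. -/
noncomputable def oddsProd (p : ℕ → ℝ) (n : ℕ) : ℝ :=
  ∏ i ∈ Finset.range n, p (i + 1) / (1 - p (i + 1))

lemma oddsProd_zero (p : ℕ → ℝ) : oddsProd p 0 = 1 := by simp [oddsProd]

lemma oddsProd_succ (p : ℕ → ℝ) (n : ℕ) :
    oddsProd p (n + 1) = oddsProd p n * (p (n + 1) / (1 - p (n + 1))) :=
  Finset.prod_range_succ _ _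

lemma oddsProd_pos {p : ℕ → ℝ} (hp : ∀ i, 0 < p (i + 1) ∧ p (i + 1) < 1) (n : ℕ) :
    0 < oddsProd p n :=
  Finset.prod_pos fun i _ => div_pos (hp i).1 (sub_pos.2 (hp i).2)

/-- In the coordinate `y = 1 / (1 - s)` the geometric generating function is the affine map
`y ↦ 1 + (p / (1 - p)) y`. -/
lemma geomPGF_one_sub_inv {p y : ℝ} (hp0 : 0 < p) (hp1 : p < 1) (hy : 1 ≤ y) :
    geomPGF p (1 - 1 / y) = 1 - 1 / (1 + p / (1 - p) * y) := by
  have h1 : 0 < 1 - p := sub_pos.2 hp1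
  have h2 : 0 < y := by linarith
  have h3 : 0 < 1 - p + p * y := by positivity
  have h4 : 1 - (1 - p) * (1 - 1 / y) = (1 - p + p * y) / y := by field_simp; ring
  have h5 : 1 + p / (1 - p) * y = (1 - p + p * y) / (1 - p) := by field_simp
  rw [geomPGF, h4, h5]
  field_simp
  ring

section Transform

variable {Ω : Type*} {X : ℕ → Ω → ℕ}

lemma pastSigma_le [mΩ : MeasurableSpace Ω] (hX : ∀ n, Measurable (X n)) (n : ℕ) :
    pastSigma X n ≤ mΩ :=
  (measurable_pi_lambda (fun ω (k : Fin (n + 1)) => X k ω) fun k => hX k).comap_le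

lemma measurable_pastSigma {i n : ℕ} (h : i ≤ n) : Measurable[pastSigma X n] (X i) :=
  (measurable_pi_apply (⟨i, Nat.lt_succ_of_le h⟩ : Fin (n + 1))).comp
    (comap_measurable fun ω (k : Fin (n + 1)) => X k ω)

lemma pastSigma_mono {m n : ℕ} (h : m ≤ n) : pastSigma X m ≤ pastSigma X n := by
  have : Measurable[pastSigma X n] (fun ω (k : Fin (m + 1)) => X k ω) :=
    @measurable_pi_lambda _ _ _ (pastSigma X n) _ _ fun k =>
      measurable_pastSigma (by have := k.2; omega)
  exact this.comap_le

variable [MeasurableSpace Ω] {P : Measure Ω} [IsProbabilityMeasure P] {p : ℕ → ℝ} {e : ℕ}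

lemma integrable_pow_of_mem_Icc {f : Ω → ℕ} (hf : Measurable f) {s : ℝ}
    (hs : s ∈ Set.Icc (0 : ℝ) 1) : Integrable (fun ω => s ^ f ω) P := by
  refine Integrable.of_bound (C := 1)
    ((measurable_from_nat (f := fun n : ℕ => s ^ n)).comp hf).aestronglyMeasurable ?_
  filter_upwards with ω
  rw [Real.norm_of_nonneg (pow_nonneg hs.1 _)]
  exact pow_le_one₀ hs.1 hs.2

/-- Iterating the one-step generating functions, in the coordinate `y = 1 / (1 - s)`. The number
`e` of immigrants per generation is arbitrary. -/
lemma setIntegral_pow_eq (hp : ∀ i, 0 < p (i + 1) ∧ p (i + 1) < 1) (hX : ∀ n, Measurable (X n))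
    (hstep : ∀ n : ℕ, ∀ s ∈ Set.Icc (0 : ℝ) 1, P[fun ω => s ^ X (n + 1) ω | pastSigma X n]
      =ᵐ[P] fun ω => geomPGF (p (n + 1)) s ^ (e + X n ω))
    {k n : ℕ} (hkn : k ≤ n) {G : Set Ω} (hG : MeasurableSet[pastSigma X k] G) {y : ℝ}
    (hy : 1 ≤ y) :
    ∫ ω in G, (1 - 1 / y) ^ X n ω ∂P =
      (oddsProd p n * y / (∑ j ∈ Finset.Ico k n, oddsProd p j + oddsProd p n * y)) ^ e *
        ∫ ω in G, (1 - oddsProd p k /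
          (∑ j ∈ Finset.Ico k n, oddsProd p j + oddsProd p n * y)) ^ X k ω ∂P := by
  induction n, hkn using Nat.le_induction generalizing y with
  | base =>
    have hA := oddsProd_pos hp k
    have hy0 : 0 < y := by linarith
    have h1 : oddsProd p k * y / (0 + oddsProd p k * y) = 1 := by
      rw [zero_add]; exact div_self (by positivity)
    have h2 : oddsProd p k / (0 + oddsProd p k * y) = 1 / y := by
      rw [zero_add]; field_simp
    simp only [Finset.Ico_self, Finset.sum_empty, h1, h2, one_pow, one_mul]
  | succ n hkn ih =>
    have hy0 : 0 < y := by linarith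
    obtain ⟨hp0, hp1⟩ := hp n
    have hρ : 0 < p (n + 1) / (1 - p (n + 1)) := div_pos hp0 (sub_pos.2 hp1)
    have hA := oddsProd_pos hp n
    have hs : 1 - 1 / y ∈ Set.Icc (0 : ℝ) 1 :=
      ⟨sub_nonneg.2 ((div_le_one hy0).2 hy), by simp; positivity⟩
    have hy' : 1 ≤ 1 + p (n + 1) / (1 - p (n + 1)) * y := by
      have := mul_pos hρ hy0
      linarith
    have hm := pastSigma_le hX n
    have h1 : ∫ ω in G, (1 - 1 / y) ^ X (n + 1) ω ∂P =
        ∫ ω in G, geomPGF (p (n + 1)) (1 - 1 / y) ^ (e + X n ω) ∂P := by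
      rw [← setIntegral_condExp hm (integrable_pow_of_mem_Icc (hX _) hs)
        (pastSigma_mono hkn _ hG)]
      exact setIntegral_congr_ae (hm _ (pastSigma_mono hkn _ hG))
        ((hstep n _ hs).mono fun ω h _ => h)
    have hden : ∑ j ∈ Finset.Ico k n, oddsProd p j
          + oddsProd p n * (1 + p (n + 1) / (1 - p (n + 1)) * y)
        = ∑ j ∈ Finset.Ico k (n + 1), oddsProd p j + oddsProd p (n + 1) * y := by
      rw [Finset.sum_Ico_succ_top hkn, oddsProd_succ]; ring
    have hfac : (1 - 1 / (1 + p (n + 1) / (1 - p (n + 1)) * y)) *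
        (oddsProd p n * (1 + p (n + 1) / (1 - p (n + 1)) * y)) = oddsProd p (n + 1) * y := by
      have : (1 + p (n + 1) / (1 - p (n + 1)) * y) ≠ 0 := by linarith
      rw [oddsProd_succ]
      generalize p (n + 1) / (1 - p (n + 1)) = r at *
      field_simp
      ring
    rw [h1, geomPGF_one_sub_inv hp0 hp1 hy]
    simp_rw [pow_add]
    rw [integral_const_mul, ih hy', hden, ← mul_assoc, ← mul_pow, ← mul_div_assoc, hfac]

/-- The probability of being extinct at time `n`, given the past up to time `k`. -/
lemma measureReal_inter_zero_eq (hp : ∀ i, 0 < p (i + 1) ∧ p (i + 1) < 1)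
    (hX : ∀ n, Measurable (X n))
    (hstep : ∀ n : ℕ, ∀ s ∈ Set.Icc (0 : ℝ) 1, P[fun ω => s ^ X (n + 1) ω | pastSigma X n]
      =ᵐ[P] fun ω => geomPGF (p (n + 1)) s ^ (e + X n ω))
    {k n : ℕ} (hkn : k ≤ n) {G : Set Ω} (hG : MeasurableSet[pastSigma X k] G) :
    P.real (G ∩ {ω | X n ω = 0}) =
      (oddsProd p n / ∑ j ∈ Finset.Icc k n, oddsProd p j) ^ e *
        ∫ ω in G, (1 - oddsProd p k / ∑ j ∈ Finset.Icc k n, oddsProd p j) ^ X k ω ∂P := by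
  have h := setIntegral_pow_eq hp hX hstep hkn hG (le_refl (1 : ℝ))
  have hz : MeasurableSet {ω | X n ω = 0} := hX n (measurableSet_singleton 0)
  have h0 : ∀ ω, (1 - 1 / (1 : ℝ)) ^ X n ω = Set.indicator {ω | X n ω = 0} (fun _ => (1 : ℝ)) ω := by
    intro ω
    by_cases hω : X n ω = 0 <;> simp [Set.indicator, hω]
  have hsum : ∑ j ∈ Finset.Ico k n, oddsProd p j + oddsProd p n * 1
      = ∑ j ∈ Finset.Icc k n, oddsProd p j := by
    rw [mul_one, ← Finset.sum_Ico_succ_top hkn]; rfl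
  simp_rw [h0] at h
  rw [integral_indicator_const _ hz, hsum, mul_one, smul_eq_mul, mul_one,
    measureReal_restrict_apply hz, Set.inter_comm] at h
  exact h

end Transform

/-! ### First-entrance decomposition of the zeros -/

section Renewal

variable {Ω : Type*}

/-- The event that the first zero of `Z` at or after time `a` occurs at time `m`. -/
def firstZeroAt (Z : ℕ → Ω → ℕ) (a m : ℕ) : Set Ω :=
  {ω | Z m ω = 0 ∧ ∀ i, a ≤ i → i < m → Z i ω ≠ 0}

/-- The event that `Z` has a zero in the time window `[a, b]`. -/
def zeroIn (Z : ℕ → Ω → ℕ) (a b : ℕ) : Set Ω := {ω | ∃ n, a ≤ n ∧ n ≤ b ∧ Z n ω = 0}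

variable {Z : ℕ → Ω → ℕ}

lemma measurableSet_firstZeroAt (a m : ℕ) :
    MeasurableSet[pastSigma Z m] (firstZeroAt Z a m) := by
  have h : firstZeroAt Z a m =
      Z m ⁻¹' {0} ∩ ⋂ i ∈ Finset.Ico a m, Z i ⁻¹' {0}ᶜ := by
    ext ω
    simp [firstZeroAt]
  rw [h]
  refine MeasurableSet.inter (measurable_pastSigma le_rfl (measurableSet_singleton 0)) ?_
  refine Finset.measurableSet_biInter _ fun i hi => ?_
  exact measurable_pastSigma (Finset.mem_Ico.1 hi).2.le (measurableSet_singleton 0).compl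

lemma disjoint_firstZeroAt {a m n : ℕ} (hm : a ≤ m) (hn : a ≤ n) (hmn : m ≠ n) :
    Disjoint (firstZeroAt Z a m) (firstZeroAt Z a n) := by
  rw [Set.disjoint_left]
  rintro ω ⟨h1, h2⟩ ⟨h3, h4⟩
  rcases lt_or_gt_of_ne hmn with h | h
  · exact h4 m hm h h1
  · exact h2 n hn h h3

lemma zeroIn_eq_biUnion (a b : ℕ) : zeroIn Z a b = ⋃ m ∈ Finset.Icc a b, firstZeroAt Z a m := by
  classical
  ext ω
  simp only [zeroIn, Set.mem_ofPred_eq, Set.mem_iUnion, Finset.mem_Icc, exists_prop]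
  constructor
  · rintro ⟨n, h1, h2, h3⟩
    have hex : ∃ n, a ≤ n ∧ Z n ω = 0 := ⟨n, h1, h3⟩
    refine ⟨Nat.find hex, ⟨(Nat.find_spec hex).1, (Nat.find_min' hex ⟨h1, h3⟩).trans h2⟩,
      (Nat.find_spec hex).2, fun i hi hlt h0 => Nat.find_min hex hlt ⟨hi, h0⟩⟩
  · rintro ⟨m, ⟨h1, h2⟩, h3, -⟩
    exact ⟨m, h1, h2, h3⟩

variable [MeasurableSpace Ω] {P : Measure Ω} [IsProbabilityMeasure P]

lemma measureReal_inter_zeroIn (hZ : ∀ n, Measurable (Z n)) (a b : ℕ) {G : Set Ω}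
    (hG : MeasurableSet G) :
    P.real (G ∩ zeroIn Z a b) = ∑ m ∈ Finset.Icc a b, P.real (G ∩ firstZeroAt Z a m) := by
  rw [zeroIn_eq_biUnion, Set.inter_iUnion₂, measureReal_biUnion_finset]
  · intro m hm n hn hmn
    exact (disjoint_firstZeroAt (Finset.mem_Icc.1 hm).1 (Finset.mem_Icc.1 hn).1 hmn).mono
      Set.inter_subset_right Set.inter_subset_right
  · exact fun m _ => hG.inter (pastSigma_le hZ m _ (measurableSet_firstZeroAt a m))

/-- First-entrance decomposition: if `u m n` is the probability of a zero at `n` given the past up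
to a zero at `m`, then the expected number of zeros in `[a, M]` splits according to the first of
them. -/
lemma sum_measureReal_inter_zero_eq (hZ : ∀ n, Measurable (Z n)) {u : ℕ → ℕ → ℝ}
    (hu : ∀ m n, m ≤ n → ∀ H, MeasurableSet[pastSigma Z m] H → (∀ ω ∈ H, Z m ω = 0) →
      P.real (H ∩ {ω | Z n ω = 0}) = u m n * P.real H)
    (a M : ℕ) {G : Set Ω} (hG : MeasurableSet[pastSigma Z a] G) :
    ∑ n ∈ Finset.Icc a M, P.real (G ∩ {ω | Z n ω = 0}) =
      ∑ m ∈ Finset.Icc a M, (∑ n ∈ Finset.Icc m M, u m n) * P.real (G ∩ firstZeroAt Z a m) := by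
  have key : ∀ n ∈ Finset.Icc a M, P.real (G ∩ {ω | Z n ω = 0}) =
      ∑ m ∈ Finset.Icc a n, u m n * P.real (G ∩ firstZeroAt Z a m) := by
    intro n hn
    have hz : MeasurableSet {ω | Z n ω = 0} := hZ n (measurableSet_singleton 0)
    have h1 : G ∩ {ω | Z n ω = 0} = (G ∩ {ω | Z n ω = 0}) ∩ zeroIn Z a n := by
      refine (Set.inter_eq_left.2 ?_).symm
      rintro ω ⟨-, h⟩
      exact ⟨n, (Finset.mem_Icc.1 hn).1, le_rfl, h⟩
    rw [h1, measureReal_inter_zeroIn hZ a n ((pastSigma_le hZ a _ hG).inter hz)]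
    refine Finset.sum_congr rfl fun m hm => ?_
    obtain ⟨ham, hmn⟩ := Finset.mem_Icc.1 hm
    rw [Set.inter_right_comm]
    exact hu m n hmn _ ((pastSigma_mono ham _ hG).inter (measurableSet_firstZeroAt a m))
      fun ω hω => hω.2.1
  rw [Finset.sum_congr rfl key]
  simp_rw [Finset.sum_mul]
  refine Finset.sum_comm' fun n m => ?_
  simp only [Finset.mem_Icc]
  omega

end Renewal

/-! ### Regeneration probabilities -/

section Immigration

variable {Ω : Type*} [MeasurableSpace Ω] {P : Measure Ω} [IsProbabilityMeasure P]
  {p : ℕ → ℝ} {Z : ℕ → Ω → ℕ}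

/-- The probability of a regeneration at time `n`, given the past up to a regeneration at `m`. -/
noncomputable def regenProb (p : ℕ → ℝ) (m n : ℕ) : ℝ :=
  oddsProd p n / ∑ j ∈ Finset.Icc m n, oddsProd p j

lemma regenProb_nonneg (hp : ∀ i, 0 < p (i + 1) ∧ p (i + 1) < 1) (m n : ℕ) :
    0 ≤ regenProb p m n :=
  div_nonneg (oddsProd_pos hp n).le (Finset.sum_nonneg fun j _ => (oddsProd_pos hp j).le)

lemma IsBranchingWithImmigration.measureReal_inter_zero_eq
    (hp : ∀ i, 0 < p (i + 1) ∧ p (i + 1) < 1) (hZ : IsBranchingWithImmigration P p Z)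
    {k n : ℕ} (hkn : k ≤ n) {G : Set Ω} (hG : MeasurableSet[pastSigma Z k] G) :
    P.real (G ∩ {ω | Z n ω = 0}) = regenProb p k n *
        ∫ ω in G, (1 - oddsProd p k / ∑ j ∈ Finset.Icc k n, oddsProd p j) ^ Z k ω ∂P := by
  rw [_root_.measureReal_inter_zero_eq hp hZ.measurable hZ.step hkn hG, pow_one, regenProb]

lemma IsBranchingWithImmigration.measureReal_regen
    (hp : ∀ i, 0 < p (i + 1) ∧ p (i + 1) < 1) (hZ : IsBranchingWithImmigration P p Z)
    {m n : ℕ} (hmn : m ≤ n) {H : Set Ω} (hH : MeasurableSet[pastSigma Z m] H)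
    (h0 : ∀ ω ∈ H, Z m ω = 0) :
    P.real (H ∩ {ω | Z n ω = 0}) = regenProb p m n * P.real H := by
  rw [hZ.measureReal_inter_zero_eq hp hmn hH]
  congr 1
  rw [setIntegral_congr_fun (pastSigma_le hZ.measurable m _ hH)
    (g := fun _ => (1 : ℝ)) (fun ω hω => by simp [h0 ω hω])]
  simp

lemma IsBranchingWithImmigration.measureReal_zero
    (hp : ∀ i, 0 < p (i + 1) ∧ p (i + 1) < 1) (hZ : IsBranchingWithImmigration P p Z) (n : ℕ) :
    P.real {ω | Z n ω = 0} = regenProb p 0 n := by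
  have h := hZ.measureReal_inter_zero_eq hp (Nat.zero_le n) (G := Set.univ) MeasurableSet.univ
  rw [Set.univ_inter, setIntegral_univ, integral_congr_ae (g := fun _ => (1 : ℝ))] at h
  · simpa using h
  · filter_upwards [hZ.init] with ω hω
    simp [hω]

/-- A lower bound for the expected number of regenerations following one in `[a, b]` bounds the
probability of a regeneration in `[a, b]`. -/
lemma IsBranchingWithImmigration.mul_measureReal_zeroIn_le
    (hp : ∀ i, 0 < p (i + 1) ∧ p (i + 1) < 1) (hZ : IsBranchingWithImmigration P p Z)
    {a b M : ℕ} (hbM : b ≤ M) {c : ℝ}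
    (hc : ∀ m ∈ Finset.Icc a b, c ≤ ∑ n ∈ Finset.Icc m M, regenProb p m n) :
    c * P.real (zeroIn Z a b) ≤ ∑ n ∈ Finset.Icc a M, regenProb p 0 n := by
  have h := sum_measureReal_inter_zero_eq hZ.measurable
    (fun m n hmn H hH h0 => hZ.measureReal_regen hp hmn hH h0) a M (G := Set.univ)
    MeasurableSet.univ
  have h2 := measureReal_inter_zeroIn (P := P) hZ.measurable a b MeasurableSet.univ
  simp only [Set.univ_inter, hZ.measureReal_zero hp] at h h2
  rw [h, h2, Finset.mul_sum]
  calc _ ≤ ∑ m ∈ Finset.Icc a b,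
        (∑ n ∈ Finset.Icc m M, regenProb p m n) * P.real (firstZeroAt Z a m) :=
        Finset.sum_le_sum fun m hm => mul_le_mul_of_nonneg_right (hc m hm) measureReal_nonneg
    _ ≤ _ := Finset.sum_le_sum_of_subset_of_nonneg (Finset.Icc_subset_Icc_right hbM)
        fun m _ _ => mul_nonneg (Finset.sum_nonneg fun n _ => regenProb_nonneg hp m n)
          measureReal_nonneg

/-- An upper bound for the expected number of regenerations following one in `[k, M]` gives a
lower bound for the probability of a regeneration in `[k, M]`. -/
lemma IsBranchingWithImmigration.sum_le_mul_measureReal_zeroIn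
    (hp : ∀ i, 0 < p (i + 1) ∧ p (i + 1) < 1) (hZ : IsBranchingWithImmigration P p Z)
    {k M : ℕ} {G : Set Ω} (hG : MeasurableSet[pastSigma Z k] G) {c : ℝ}
    (hc : ∀ m ∈ Finset.Icc k M, ∑ n ∈ Finset.Icc m M, regenProb p m n ≤ c) :
    ∑ n ∈ Finset.Icc k M, P.real (G ∩ {ω | Z n ω = 0}) ≤ c * P.real (G ∩ zeroIn Z k M) := by
  rw [sum_measureReal_inter_zero_eq hZ.measurable
    (fun m n hmn H hH h0 => hZ.measureReal_regen hp hmn hH h0) k M hG,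
    measureReal_inter_zeroIn hZ.measurable k M (pastSigma_le hZ.measurable k _ hG),
    Finset.mul_sum]
  exact Finset.sum_le_sum fun m hm => mul_le_mul_of_nonneg_right (hc m hm) measureReal_nonneg

end Immigration

/-! ### Weights of the near-critical environment -/

section Environment

variable {B i₀ : ℝ}

lemma nearCritical_of_le {n : ℕ} (h : (n : ℝ) ≤ i₀) : nearCritical B i₀ n = 1 / 2 := by
  simp [nearCritical, not_lt.2 h]

lemma nearCritical_of_lt {n : ℕ} (h : i₀ < (n : ℝ)) :
    nearCritical B i₀ n = 1 / 2 - B / (4 * (n : ℝ)) := by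
  simp [nearCritical, h]

lemma lt_two_mul_of_lt (hi₀ : 0 < i₀) (hBi₀ : B / (4 * i₀) < 1 / 2) {x : ℝ} (h : i₀ < x) :
    B < 2 * x := by
  rw [div_lt_iff₀ (by positivity)] at hBi₀
  linarith

lemma nearCritical_pos_and_lt_one (hB : 0 ≤ B) (hi₀ : 0 < i₀) (hBi₀ : B / (4 * i₀) < 1 / 2)
    (i : ℕ) : 0 < nearCritical B i₀ (i + 1) ∧ nearCritical B i₀ (i + 1) < 1 := by
  rcases le_or_gt ((i + 1 : ℕ) : ℝ) i₀ with h | h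
  · rw [nearCritical_of_le h]; norm_num
  · have h1 := lt_two_mul_of_lt hi₀ hBi₀ h
    have h2 : (0 : ℝ) < 4 * ((i + 1 : ℕ) : ℝ) := by positivity
    have h3 : B / (4 * ((i + 1 : ℕ) : ℝ)) < 1 / 2 := by rw [div_lt_iff₀ h2]; linarith
    have h4 : 0 ≤ B / (4 * ((i + 1 : ℕ) : ℝ)) := by positivity
    rw [nearCritical_of_lt h]
    constructor <;> linarith

lemma odds_nearCritical_of_le {n : ℕ} (h : (n : ℝ) ≤ i₀) :
    nearCritical B i₀ n / (1 - nearCritical B i₀ n) = 1 := by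
  rw [nearCritical_of_le h]; norm_num

lemma odds_nearCritical_of_lt (hi₀ : 0 < i₀) {n : ℕ} (h : i₀ < (n : ℝ)) :
    nearCritical B i₀ n / (1 - nearCritical B i₀ n) = (2 * n - B) / (2 * n + B) := by
  have hn : (0 : ℝ) < n := hi₀.trans h
  have h1 : 1 / 2 - B / (4 * (n : ℝ)) = (2 * n - B) / (4 * n) := by
    field_simp
    ring
  have h2 : 1 - (2 * n - B) / (4 * n) = (2 * n + B) / (4 * n) := by field_simp; ring
  rw [nearCritical_of_lt h, h1, h2, div_div_div_cancel_right₀ (by positivity)]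

lemma oddsProd_nearCritical_succ_le (hB : 0 ≤ B) (hi₀ : 0 < i₀) (hBi₀ : B / (4 * i₀) < 1 / 2)
    (n : ℕ) : oddsProd (nearCritical B i₀) (n + 1) ≤ oddsProd (nearCritical B i₀) n := by
  rw [oddsProd_succ]
  refine mul_le_of_le_one_right
    (oddsProd_pos (nearCritical_pos_and_lt_one hB hi₀ hBi₀) n).le ?_
  rcases le_or_gt ((n + 1 : ℕ) : ℝ) i₀ with h | h
  · rw [odds_nearCritical_of_le h]
  · have := hi₀.trans h
    rw [odds_nearCritical_of_lt hi₀ h, div_le_one (by positivity)]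
    linarith

/-- If `B ≤ 1` then `(2 n + 1) A n` is nondecreasing, which bounds `A n` below. -/
lemma one_div_le_oddsProd_nearCritical (hB : 0 ≤ B) (hB1 : B ≤ 1) (hi₀ : 0 < i₀) (n : ℕ) :
    1 / (2 * (n : ℝ) + 1) ≤ oddsProd (nearCritical B i₀) n := by
  induction n with
  | zero => simp [oddsProd_zero]
  | succ n ih =>
    rw [oddsProd_succ]
    have h0 : (2 * (n : ℝ) + 1) / (2 * n + 3) ≤
        nearCritical B i₀ (n + 1) / (1 - nearCritical B i₀ (n + 1)) := by
      rcases le_or_gt ((n + 1 : ℕ) : ℝ) i₀ with h | h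
      · rw [odds_nearCritical_of_le h, div_le_one (by positivity)]
        linarith
      · rw [odds_nearCritical_of_lt hi₀ h, div_le_div_iff₀ (by positivity) (by positivity)]
        push_cast
        nlinarith [(Nat.cast_nonneg n : (0 : ℝ) ≤ n)]
    calc 1 / (2 * ((n + 1 : ℕ) : ℝ) + 1)
        = 1 / (2 * (n : ℝ) + 1) * ((2 * (n : ℝ) + 1) / (2 * n + 3)) := by
          push_cast; field_simp; ring
      _ ≤ _ := mul_le_mul ih h0 (by positivity) (le_trans (by positivity) ih)

lemma tendsto_sum_oddsProd_nearCritical (hB : 0 ≤ B) (hB1 : B ≤ 1) (hi₀ : 0 < i₀) :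
    Filter.Tendsto (fun n => ∑ j ∈ Finset.range n, oddsProd (nearCritical B i₀) j)
      Filter.atTop Filter.atTop := by
  refine Filter.tendsto_atTop_mono (fun n => ?_)
    (Real.tendsto_sum_range_one_div_nat_succ_atTop.const_mul_atTop (r := 1 / 2) (by norm_num))
  rw [Finset.mul_sum]
  refine Finset.sum_le_sum fun j _ => le_trans ?_ (one_div_le_oddsProd_nearCritical hB hB1 hi₀ j)
  rw [one_div_mul_one_div]
  exact one_div_le_one_div_of_le (by positivity) (by linarith)

lemma tendsto_sum_Icc_oddsProd_nearCritical (hB : 0 ≤ B) (hB1 : B ≤ 1) (hi₀ : 0 < i₀) (k : ℕ) :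
    Filter.Tendsto (fun n => ∑ j ∈ Finset.Icc k n, oddsProd (nearCritical B i₀) j)
      Filter.atTop Filter.atTop := by
  have h := Filter.tendsto_atTop_add_const_right _
    (-∑ j ∈ Finset.range k, oddsProd (nearCritical B i₀) j)
    ((tendsto_sum_oddsProd_nearCritical hB hB1 hi₀).comp (Filter.tendsto_add_atTop_nat 1))
  refine h.congr' ?_
  filter_upwards [Filter.eventually_ge_atTop k] with n hn
  have : Finset.Icc k n = Finset.Ico k (n + 1) := rfl
  rw [this, Finset.sum_Ico_eq_sub _ (by omega), Function.comp_apply, sub_eq_add_neg]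

/-- A regeneration occurs at time `n` with probability at least `(1 - B) / (n + 1)`, which is of
interest for `B < 1`. -/
lemma le_regenProb_zero (hB : 0 ≤ B) (hi₀ : 0 < i₀) (hBi₀ : B / (4 * i₀) < 1 / 2)
    (n : ℕ) : (1 - B) / (n + 1) ≤ regenProb (nearCritical B i₀) 0 n := by
  have hA := oddsProd_pos (nearCritical_pos_and_lt_one hB hi₀ hBi₀)
  -- With the shift `- B / 2`, both sides grow by the same amount as soon as `n + 1 > i₀`.
  have key : (1 - B) * ∑ j ∈ Finset.Icc 0 n, oddsProd (nearCritical B i₀) j ≤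
      (n + 1 - B / 2) * oddsProd (nearCritical B i₀) n := by
    induction n with
    | zero => simp [oddsProd_zero]; linarith
    | succ n ih =>
      rw [Finset.sum_Icc_succ_top (Nat.zero_le _), mul_add]
      have h0 : (n + 1 - B / 2) * oddsProd (nearCritical B i₀) n ≤
          (n + 1 + B / 2) * oddsProd (nearCritical B i₀) (n + 1) := by
        rw [oddsProd_succ]
        rcases le_or_gt ((n + 1 : ℕ) : ℝ) i₀ with h | h
        · rw [odds_nearCritical_of_le h, mul_one]
          exact mul_le_mul_of_nonneg_right (by linarith) (hA n).le
        · rw [odds_nearCritical_of_lt hi₀ h]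
          push_cast
          have : (0 : ℝ) < 2 * (n + 1) + B := by positivity
          apply le_of_eq
          field_simp
      push_cast
      nlinarith [hA (n + 1)]
  have hS : 0 < ∑ j ∈ Finset.Icc 0 n, oddsProd (nearCritical B i₀) j :=
    Finset.sum_pos (fun j _ => hA j) ⟨0, by simp⟩
  rw [regenProb, div_le_div_iff₀ (by positivity) hS]
  nlinarith [hA n]

lemma antitone_oddsProd_nearCritical (hB : 0 ≤ B) (hi₀ : 0 < i₀) (hBi₀ : B / (4 * i₀) < 1 / 2) :
    Antitone (oddsProd (nearCritical B i₀)) :=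
  antitone_nat_of_succ_le (oddsProd_nearCritical_succ_le hB hi₀ hBi₀)

lemma regenProb_zero_le {p : ℕ → ℝ} (hp : ∀ i, 0 < p (i + 1) ∧ p (i + 1) < 1)
    (m n : ℕ) (hmn : m ≤ n) : regenProb p 0 n ≤ regenProb p m n := by
  have hA := oddsProd_pos hp
  exact div_le_div_of_nonneg_left (hA n).le
    (Finset.sum_pos (fun j _ => hA j) ⟨n, by simp [hmn]⟩)
    (Finset.sum_le_sum_of_subset_of_nonneg (Finset.Icc_subset_Icc_left (Nat.zero_le m))
      fun j _ _ => (hA j).le)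

lemma sum_Icc_one_div_sub (m M : ℕ) :
    ∑ n ∈ Finset.Icc m M, 1 / (((n - m : ℕ) : ℝ) + 1) =
      ∑ i ∈ Finset.range (M + 1 - m), 1 / ((i : ℝ) + 1) := by
  have : Finset.Icc m M = Finset.Ico m (M + 1) := rfl
  rw [this, Finset.sum_Ico_eq_sum_range]
  simp

/-- After a regeneration at `m`, another one occurs at `n` with probability at most
`1 / (n - m + 1)`, because the weights are nonincreasing. -/
lemma sum_regenProb_le (hB : 0 ≤ B) (hi₀ : 0 < i₀) (hBi₀ : B / (4 * i₀) < 1 / 2) (m M : ℕ) :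
    ∑ n ∈ Finset.Icc m M, regenProb (nearCritical B i₀) m n ≤
      ∑ i ∈ Finset.range (M + 1), 1 / ((i : ℝ) + 1) := by
  have hA := oddsProd_pos (nearCritical_pos_and_lt_one hB hi₀ hBi₀)
  calc _ ≤ ∑ n ∈ Finset.Icc m M, 1 / (((n - m : ℕ) : ℝ) + 1) := by
        refine Finset.sum_le_sum fun n hn => ?_
        have hmn := (Finset.mem_Icc.1 hn).1
        have h1 : (((n - m : ℕ) : ℝ) + 1) * oddsProd (nearCritical B i₀) n ≤
            ∑ j ∈ Finset.Icc m n, oddsProd (nearCritical B i₀) j := by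
          have := Finset.card_nsmul_le_sum (Finset.Icc m n) (oddsProd (nearCritical B i₀)) _
            fun j hj => antitone_oddsProd_nearCritical hB hi₀ hBi₀ (Finset.mem_Icc.1 hj).2
          rwa [Nat.card_Icc, nsmul_eq_mul, Nat.sub_add_comm hmn, Nat.cast_add_one] at this
        rw [regenProb, div_le_div_iff₀ (lt_of_lt_of_le (mul_pos (by positivity) (hA n)) h1)
          (by positivity)]
        linarith
    _ = _ := sum_Icc_one_div_sub m M
    _ ≤ _ := Finset.sum_le_sum_of_subset_of_nonneg
        (Finset.range_mono (Nat.sub_le _ _)) fun i _ _ => by positivity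

/-- If `B ≥ 1` then `(2 n + 1) A n` is eventually nonincreasing, so that the sum of the weights up
to time `n` is at least of the order `n (log n) A n`. -/
lemma exists_mul_harmonic_le_sum_oddsProd (hB1 : 1 ≤ B) (hi₀ : 0 < i₀)
    (hBi₀ : B / (4 * i₀) < 1 / 2) :
    ∃ c : ℝ, 0 < c ∧ ∃ N : ℕ, ∀ n, N ≤ n →
      c * ((2 * n + 1) * oddsProd (nearCritical B i₀) n *
        ∑ i ∈ Finset.range (n + 1), 1 / ((i : ℝ) + 1)) ≤
      ∑ j ∈ Finset.Icc 0 n, oddsProd (nearCritical B i₀) j := by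
  have hB : 0 ≤ B := by linarith
  have hA := oddsProd_pos (nearCritical_pos_and_lt_one hB hi₀ hBi₀)
  have hH : ∀ n : ℕ, 0 < ∑ i ∈ Finset.range (n + 1), 1 / ((i : ℝ) + 1) := fun n =>
    Finset.sum_pos (fun i _ => by positivity) ⟨0, by simp⟩
  obtain ⟨N, hN⟩ := exists_nat_gt i₀
  set W := (2 * N + 1) * oddsProd (nearCritical B i₀) N *
    ∑ i ∈ Finset.range (N + 1), 1 / ((i : ℝ) + 1)
  have hW : 0 < W := mul_pos (mul_pos (by positivity) (hA N)) (hH N)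
  have hS : 0 < ∑ j ∈ Finset.Icc 0 N, oddsProd (nearCritical B i₀) j :=
    Finset.sum_pos (fun j _ => hA j) ⟨0, by simp⟩
  refine ⟨min (1 / 2) ((∑ j ∈ Finset.Icc 0 N, oddsProd (nearCritical B i₀) j) / W),
    lt_min (by norm_num) (div_pos hS hW), N, fun n hn => ?_⟩
  set c := min (1 / 2) ((∑ j ∈ Finset.Icc 0 N, oddsProd (nearCritical B i₀) j) / W) with hc
  have hc0 : 0 < c := lt_min (by norm_num) (div_pos hS hW)
  have hc2 : c ≤ 1 / 2 := min_le_left _ _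
  induction n, hn using Nat.le_induction with
  | base => exact (le_div_iff₀ hW).1 (min_le_right _ _)
  | succ n hn ih =>
    have hlt : i₀ < ((n + 1 : ℕ) : ℝ) := hN.trans_le (by exact_mod_cast Nat.le_succ_of_le hn)
    have hmono : (2 * ((n + 1 : ℕ) : ℝ) + 1) * oddsProd (nearCritical B i₀) (n + 1) ≤
        (2 * n + 1) * oddsProd (nearCritical B i₀) n := by
      have h1 := lt_two_mul_of_lt hi₀ hBi₀ hlt
      have h2 : (2 * ((n + 1 : ℕ) : ℝ) + 1) *
          ((2 * ((n + 1 : ℕ) : ℝ) - B) / (2 * ((n + 1 : ℕ) : ℝ) + B)) ≤ 2 * n + 1 := by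
        rw [← mul_div_assoc, div_le_iff₀ (by positivity)]
        push_cast
        nlinarith [(Nat.cast_nonneg n : (0 : ℝ) ≤ n)]
      rw [oddsProd_succ, odds_nearCritical_of_lt hi₀ hlt]
      nlinarith [mul_le_mul_of_nonneg_right h2 (hA n).le]
    have hlast : (2 * ((n + 1 : ℕ) : ℝ) + 1) * (1 / (((n + 1 : ℕ) : ℝ) + 1)) ≤ 2 := by
      rw [mul_one_div, div_le_iff₀ (by positivity)]
      push_cast
      linarith
    rw [Finset.sum_range_succ, Finset.sum_Icc_succ_top (Nat.zero_le _), mul_add, mul_add]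
    refine add_le_add (le_trans ?_ ih) ?_
    · exact mul_le_mul_of_nonneg_left (mul_le_mul_of_nonneg_right hmono (hH n).le) hc0.le
    · calc _ = c * ((2 * ((n + 1 : ℕ) : ℝ) + 1) * (1 / (((n + 1 : ℕ) : ℝ) + 1))) *
            oddsProd (nearCritical B i₀) (n + 1) := by ring
        _ ≤ (1 / 2 * 2) * oddsProd (nearCritical B i₀) (n + 1) :=
          mul_le_mul_of_nonneg_right (mul_le_mul hc2 hlast (by positivity) (by norm_num))
            (hA _).le
        _ = _ := by ring

/-- The weights vary by a bounded factor between `m` and `2 m`, because `(n + 1) ^ K * A n` is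
eventually nondecreasing for `K ≥ 2 B`. -/
lemma exists_mul_oddsProd_le (hB : 0 ≤ B) (hi₀ : 0 < i₀) (hBi₀ : B / (4 * i₀) < 1 / 2) :
    ∃ c : ℝ, 0 < c ∧ ∃ N : ℕ, ∀ m n, N ≤ m → m ≤ n → n ≤ 2 * m →
      c * oddsProd (nearCritical B i₀) m ≤ oddsProd (nearCritical B i₀) n := by
  have hA := oddsProd_pos (nearCritical_pos_and_lt_one hB hi₀ hBi₀)
  obtain ⟨K, hK⟩ := exists_nat_ge (2 * B)
  obtain ⟨N, hN⟩ := exists_nat_gt (max i₀ B)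
  have hmono : ∀ m n, N ≤ m → m ≤ n →
      ((m : ℝ) + 1) ^ K * oddsProd (nearCritical B i₀) m ≤
        ((n : ℝ) + 1) ^ K * oddsProd (nearCritical B i₀) n := by
    intro m n hm hmn
    induction n, hmn using Nat.le_induction with
    | base => rfl
    | succ n hmn ih =>
      refine ih.trans ?_
      have hNn : max i₀ B < ((n + 1 : ℕ) : ℝ) :=
        hN.trans_le (by exact_mod_cast (hm.trans hmn).trans (Nat.le_succ n))
      have hi : i₀ < ((n + 1 : ℕ) : ℝ) := (le_max_left _ _).trans_lt hNn
      have hBn : B < ((n + 1 : ℕ) : ℝ) := (le_max_right _ _).trans_lt hNn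
      rw [oddsProd_succ, odds_nearCritical_of_lt hi₀ hi]
      set x : ℝ := ((n + 1 : ℕ) : ℝ) with hx
      have hx0 : 0 < x := hi₀.trans hi
      have hnx : (n : ℝ) + 1 = x := by rw [hx]; push_cast; ring
      rw [hnx]
      -- Bernoulli's inequality for `(1 + 1 / x) ^ K`.
      have hb : 1 + K * (1 / x) ≤ (1 + 1 / x) ^ K :=
        one_add_mul_le_pow (le_trans (by norm_num) (by positivity : (0 : ℝ) ≤ 1 / x)) K
      have h1 : (2 * x + B) / (2 * x - B) ≤ (1 + 1 / x) ^ K := by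
        refine le_trans ?_ hb
        have h2 : 0 < 2 * x - B := by linarith
        rw [div_le_iff₀ h2]
        have h3 : 1 + (K : ℝ) * (1 / x) = (x + K) / x := by field_simp
        rw [h3, div_mul_eq_mul_div, le_div_iff₀ hx0]
        nlinarith
      have h4 : 0 < 2 * x - B := by linarith
      have h5 : x ^ K ≤ (x + 1) ^ K * ((2 * x - B) / (2 * x + B)) := by
        have h6 : (x + 1) ^ K = x ^ K * (1 + 1 / x) ^ K := by
          rw [← mul_pow]; congr 1; field_simp
        rw [h6, mul_assoc]
        refine le_mul_of_one_le_right (by positivity) ?_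
        rw [div_le_iff₀ h4] at h1
        rw [← mul_div_assoc, le_div_iff₀ (by positivity)]
        linarith
      nlinarith [mul_le_mul_of_nonneg_right h5 (hA n).le]
  refine ⟨(1 / 2) ^ K, by positivity, N, fun m n hm hmn hn => ?_⟩
  have h1 := hmono m n hm hmn
  have h2 : ((n : ℝ) + 1) ^ K ≤ (2 * ((m : ℝ) + 1)) ^ K := by
    have : (n : ℝ) ≤ 2 * m := by exact_mod_cast hn
    exact pow_le_pow_left₀ (by positivity) (by linarith) K
  have h3 : (0 : ℝ) < ((m : ℝ) + 1) ^ K := by positivity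
  have h4 : oddsProd (nearCritical B i₀) m ≤ 2 ^ K * oddsProd (nearCritical B i₀) n := by
    rw [mul_pow] at h2
    have := h1.trans (mul_le_mul_of_nonneg_right h2 (hA n).le)
    refine le_of_mul_le_mul_left ?_ h3
    linarith
  rw [one_div, inv_pow, inv_mul_le_iff₀ (by positivity)]
  exact h4

/-- After a regeneration at `m`, the expected number of regenerations in `[m, 2 m]` is at least of
the order `log m`. -/
lemma exists_mul_harmonic_le_sum_regenProb (hB : 0 ≤ B) (hi₀ : 0 < i₀)
    (hBi₀ : B / (4 * i₀) < 1 / 2) :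
    ∃ c : ℝ, 0 < c ∧ ∃ N : ℕ, ∀ m, N ≤ m →
      c * ∑ i ∈ Finset.range (m + 1), 1 / ((i : ℝ) + 1) ≤
        ∑ n ∈ Finset.Icc m (2 * m), regenProb (nearCritical B i₀) m n := by
  have hA := oddsProd_pos (nearCritical_pos_and_lt_one hB hi₀ hBi₀)
  obtain ⟨c, hc, N, h⟩ := exists_mul_oddsProd_le hB hi₀ hBi₀
  refine ⟨c, hc, N, fun m hm => ?_⟩
  have h0 := sum_Icc_one_div_sub m (2 * m)
  rw [show 2 * m + 1 - m = m + 1 by omega] at h0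
  rw [← h0, Finset.mul_sum]
  refine Finset.sum_le_sum fun n hn => ?_
  obtain ⟨hmn, hn2⟩ := Finset.mem_Icc.1 hn
  have h1 : ∑ j ∈ Finset.Icc m n, oddsProd (nearCritical B i₀) j ≤
      (((n - m : ℕ) : ℝ) + 1) * oddsProd (nearCritical B i₀) m := by
    have := Finset.sum_le_card_nsmul (Finset.Icc m n) (oddsProd (nearCritical B i₀)) _
      fun j hj => antitone_oddsProd_nearCritical hB hi₀ hBi₀ (Finset.mem_Icc.1 hj).1
    rwa [Nat.card_Icc, nsmul_eq_mul, Nat.sub_add_comm hmn, Nat.cast_add_one] at this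
  have hS : 0 < ∑ j ∈ Finset.Icc m n, oddsProd (nearCritical B i₀) j :=
    Finset.sum_pos (fun j _ => hA j) ⟨n, by simp [hmn]⟩
  rw [regenProb, mul_one_div, div_le_div_iff₀ (by positivity) hS]
  calc _ ≤ c * ((((n - m : ℕ) : ℝ) + 1) * oddsProd (nearCritical B i₀) m) :=
        mul_le_mul_of_nonneg_left h1 hc.le
    _ = (c * oddsProd (nearCritical B i₀) m) * (((n - m : ℕ) : ℝ) + 1) := by ring
    _ ≤ _ := mul_le_mul_of_nonneg_right (h m n hm hmn hn2) (by positivity)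

end Environment

lemma log_add_one_le_sum (n : ℕ) :
    Real.log (n + 1) ≤ ∑ i ∈ Finset.range n, 1 / ((i : ℝ) + 1) := by
  have h := log_add_one_le_harmonic n
  simpa [harmonic, one_div] using h

/-! ### Finitely many regenerations for `B ≥ 1` -/

section FinitelyMany

variable {Ω : Type*} [MeasurableSpace Ω] {P : Measure Ω} [IsProbabilityMeasure P]
  {B i₀ : ℝ} {Z : ℕ → Ω → ℕ}

lemma log_two_mul_le_sum {j n : ℕ} (h : 2 ^ j ≤ n) :
    Real.log 2 * j ≤ ∑ i ∈ Finset.range (n + 1), 1 / ((i : ℝ) + 1) := by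
  refine le_trans ?_ (log_add_one_le_sum (n + 1))
  have h1 : (2 : ℝ) ^ j ≤ n := by exact_mod_cast h
  rw [mul_comm, ← Real.log_pow]
  refine Real.log_le_log (by positivity) ?_
  push_cast
  linarith

/-- The probability of a regeneration in `[2 ^ j, 2 ^ (j + 1)]` is of the order `1 / j ^ 2`: the
expected number of regenerations in `[2 ^ j, 2 ^ (j + 2)]` is of the order `1 / j`, but it is at
least of the order `j` once there is one in the first half. -/
lemma IsBranchingWithImmigration.exists_measureReal_zeroIn_le (hB1 : 1 ≤ B) (hi₀ : 0 < i₀)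
    (hBi₀ : B / (4 * i₀) < 1 / 2) (hZ : IsBranchingWithImmigration P (nearCritical B i₀) Z) :
    ∃ C : ℝ, ∃ J : ℕ, ∀ j, J ≤ j →
      P.real (zeroIn Z (2 ^ j) (2 ^ (j + 1))) ≤ C * (1 / (j : ℝ) ^ 2) := by
  have hB : 0 ≤ B := by linarith
  have hp := nearCritical_pos_and_lt_one hB hi₀ hBi₀
  have hA := oddsProd_pos hp
  obtain ⟨c, hc, N, h1⟩ := exists_mul_harmonic_le_sum_regenProb hB hi₀ hBi₀
  obtain ⟨d, hd, N', h2⟩ := exists_mul_harmonic_le_sum_oddsProd hB1 hi₀ hBi₀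
  have hl : 0 < Real.log 2 := Real.log_pos one_lt_two
  refine ⟨2 / (c * d * Real.log 2 ^ 2), N + N' + 1, fun j hj => ?_⟩
  have hj2 : j ≤ 2 ^ j := Nat.lt_two_pow_self.le
  have hj0 : (0 : ℝ) < j := by exact_mod_cast (by omega : 0 < j)
  have hlow : c * (Real.log 2 * j) * P.real (zeroIn Z (2 ^ j) (2 ^ (j + 1))) ≤
      ∑ n ∈ Finset.Icc (2 ^ j) (2 ^ (j + 2)), regenProb (nearCritical B i₀) 0 n := by
    refine hZ.mul_measureReal_zeroIn_le hp (Nat.pow_le_pow_right (by norm_num) (by omega))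
      fun m hm => ?_
    obtain ⟨hm1, hm2⟩ := Finset.mem_Icc.1 hm
    calc _ ≤ c * ∑ i ∈ Finset.range (m + 1), 1 / ((i : ℝ) + 1) :=
          mul_le_mul_of_nonneg_left (log_two_mul_le_sum hm1) hc.le
      _ ≤ _ := h1 m (by omega)
      _ ≤ _ := Finset.sum_le_sum_of_subset_of_nonneg
          (Finset.Icc_subset_Icc_right (by rw [pow_succ] at hm2 ⊢; rw [pow_succ]; omega))
          fun n _ _ => regenProb_nonneg hp m n
  have hterm : ∀ n ∈ Finset.Icc (2 ^ j) (2 ^ (j + 2)), regenProb (nearCritical B i₀) 0 n ≤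
      1 / (d * (2 * 2 ^ j * (Real.log 2 * j))) := by
    intro n hn
    obtain ⟨hn1, hn2⟩ := Finset.mem_Icc.1 hn
    have hS : 0 < ∑ j ∈ Finset.Icc 0 n, oddsProd (nearCritical B i₀) j :=
      Finset.sum_pos (fun j _ => hA j) ⟨0, by simp⟩
    have hn1' : (2 : ℝ) ^ j ≤ n := by exact_mod_cast hn1
    rw [regenProb, div_le_div_iff₀ hS (by positivity), one_mul]
    refine le_trans ?_ (h2 n (by omega))
    calc _ = d * (2 * 2 ^ j * oddsProd (nearCritical B i₀) n * (Real.log 2 * j)) := by ring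
      _ ≤ _ := by
        have := log_two_mul_le_sum hn1
        have := hA n
        gcongr
        linarith
  have hup := Finset.sum_le_card_nsmul _ _ _ hterm
  rw [nsmul_eq_mul, Nat.card_Icc] at hup
  have hcard : ((2 ^ (j + 2) + 1 - 2 ^ j : ℕ) : ℝ) ≤ 4 * 2 ^ j := by
    have : 2 ^ (j + 2) + 1 - 2 ^ j ≤ 4 * 2 ^ j := by
      have := Nat.one_le_two_pow (n := j)
      rw [pow_add]; omega
    exact_mod_cast this
  have hfin : c * (Real.log 2 * j) * P.real (zeroIn Z (2 ^ j) (2 ^ (j + 1))) ≤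
      4 * 2 ^ j * (1 / (d * (2 * 2 ^ j * (Real.log 2 * j)))) :=
    (hlow.trans hup).trans (mul_le_mul_of_nonneg_right hcard (by positivity))
  have heq : 4 * 2 ^ j * (1 / (d * (2 * 2 ^ j * (Real.log 2 * j)))) =
      c * (Real.log 2 * j) * (2 / (c * d * Real.log 2 ^ 2) * (1 / (j : ℝ) ^ 2)) := by
    field_simp
    norm_num
  rw [heq] at hfin
  exact le_of_mul_le_mul_left hfin (by positivity)

lemma IsBranchingWithImmigration.ae_finite_regenerationTimes (hB1 : 1 ≤ B) (hi₀ : 0 < i₀)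
    (hBi₀ : B / (4 * i₀) < 1 / 2) (hZ : IsBranchingWithImmigration P (nearCritical B i₀) Z) :
    ∀ᵐ ω ∂P, (regenerationTimes Z ω).Finite := by
  obtain ⟨C, J, hC⟩ := hZ.exists_measureReal_zeroIn_le hB1 hi₀ hBi₀
  have hsum : Summable fun j : ℕ => P.real (zeroIn Z (2 ^ j) (2 ^ (j + 1))) := by
    refine Summable.of_norm_bounded_eventually_nat
      ((Real.summable_one_div_nat_pow.2 one_lt_two).mul_left C) ?_
    filter_upwards [Filter.eventually_ge_atTop J] with j hj
    rw [Real.norm_of_nonneg measureReal_nonneg]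
    exact hC j hj
  have htop : ∑' j : ℕ, P (zeroIn Z (2 ^ j) (2 ^ (j + 1))) ≠ ⊤ := by
    have heq : ∀ j : ℕ, ENNReal.ofReal (P.real (zeroIn Z (2 ^ j) (2 ^ (j + 1)))) =
        P (zeroIn Z (2 ^ j) (2 ^ (j + 1))) := fun j => ofReal_measureReal
    simpa only [heq] using hsum.tsum_ofReal_ne_top
  filter_upwards [ae_eventually_notMem htop] with ω hω
  obtain ⟨j₀, hj₀⟩ := Filter.eventually_atTop.1 hω
  refine (Set.finite_lt_nat (2 ^ j₀)).subset fun n hn => ?_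
  by_contra hlt
  have hlt : 2 ^ j₀ ≤ n := not_lt.1 hlt
  have hn0 : n ≠ 0 := by have := Nat.one_le_two_pow (n := j₀); omega
  exact hj₀ (Nat.log 2 n) ((Nat.le_log_iff_pow_le one_lt_two hn0).2 hlt)
    ⟨n, Nat.pow_log_le_self 2 hn0, (Nat.lt_pow_succ_log_self one_lt_two n).le, hn⟩

end FinitelyMany

/-! ### Infinitely many regenerations for `B < 1` -/

section InfinitelyMany

variable {Ω : Type*} [mΩ : MeasurableSpace Ω] {P : Measure Ω} [IsProbabilityMeasure P]
  {B i₀ : ℝ} {Z : ℕ → Ω → ℕ}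

lemma le_of_forall_mul_sub_le_mul {h : ℕ → ℝ} (hh : Filter.Tendsto h Filter.atTop Filter.atTop)
    {α c d : ℝ} {N : ℕ} (H : ∀ M, N ≤ M → α * (h M - d) ≤ c * h M) : α ≤ c := by
  by_contra hlt
  have h1 : Filter.Tendsto (fun M => (α - c) * h M) Filter.atTop Filter.atTop :=
    hh.const_mul_atTop (by linarith)
  obtain ⟨M, hM1, hM2⟩ := ((h1.eventually_gt_atTop (α * d)).and
    (Filter.eventually_ge_atTop N)).exists
  linarith [H M hM2]

/-- If `S n → ∞` then `(1 - a / S n) ^ f` tends to `1` pointwise, hence in mean. -/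
lemma tendsto_setIntegral_one_sub_div_pow {f : Ω → ℕ} (hf : Measurable f) {a : ℝ} {S : ℕ → ℝ}
    (hS : Filter.Tendsto S Filter.atTop Filter.atTop) (ha : 0 ≤ a)
    (haS : ∀ᶠ n in Filter.atTop, a ≤ S n) (G : Set Ω) :
    Filter.Tendsto (fun n => ∫ ω in G, (1 - a / S n) ^ f ω ∂P) Filter.atTop
      (nhds (P.real G)) := by
  have h1 : Filter.Tendsto (fun n => 1 - a / S n) Filter.atTop (nhds 1) := by
    simpa using (hS.const_div_atTop a).const_sub 1
  have h2 : P.real G = ∫ _ω in G, (1 : ℝ) ∂P := by simp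
  rw [h2]
  refine tendsto_integral_filter_of_dominated_convergence (fun _ => 1)
    (Filter.Eventually.of_forall fun n =>
      ((measurable_from_nat (f := fun k : ℕ => (1 - a / S n) ^ k)).comp hf).aestronglyMeasurable)
    ?_ (integrable_const _) (Filter.Eventually.of_forall fun ω => by simpa using h1.pow (f ω))
  filter_upwards [haS, hS.eventually_gt_atTop 0] with n hn hn0
  filter_upwards with ω
  have h3 : a / S n ≤ 1 := (div_le_one hn0).2 hn
  have h4 : 0 ≤ a / S n := div_nonneg ha hn0.le
  rw [Real.norm_of_nonneg (pow_nonneg (by linarith) _)]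
  exact pow_le_one₀ (by linarith) (by linarith)

/-- Whatever the past up to time `k`, a regeneration at or after `k` has conditional probability
at least `1 - B`. -/
lemma IsBranchingWithImmigration.le_measureReal_exists_zero (hB : 0 ≤ B) (hB1 : B < 1)
    (hi₀ : 0 < i₀) (hBi₀ : B / (4 * i₀) < 1 / 2)
    (hZ : IsBranchingWithImmigration P (nearCritical B i₀) Z) {k : ℕ} {G : Set Ω}
    (hG : MeasurableSet[pastSigma Z k] G) :
    (1 - B) * P.real G ≤ P.real (G ∩ {ω | ∃ n, k ≤ n ∧ Z n ω = 0}) := by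
  have hp := nearCritical_pos_and_lt_one hB hi₀ hBi₀
  have hA := oddsProd_pos hp
  have hS := tendsto_sum_Icc_oddsProd_nearCritical hB hB1.le hi₀ k
  have hlim := tendsto_setIntegral_one_sub_div_pow (P := P) (hZ.measurable k) hS (hA k).le
    (hS.eventually_ge_atTop _) G
  -- It suffices to prove the bound with any `κ < P G` in place of `P G`.
  rw [mul_comm, ← le_div_iff₀ (by linarith)]
  refine le_of_forall_lt_imp_le_of_dense fun κ hκ => ?_
  rcases lt_or_ge κ 0 with hκ0 | hκ0
  · exact hκ0.le.trans (div_nonneg measureReal_nonneg (by linarith))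
  rw [le_div_iff₀ (by linarith)]
  obtain ⟨N, hN⟩ := Filter.eventually_atTop.1 (hlim.eventually_const_lt hκ)
  have hH := Real.tendsto_sum_range_one_div_nat_succ_atTop.comp (Filter.tendsto_add_atTop_nat 1)
  refine le_of_forall_mul_sub_le_mul hH (N := max N k)
    (d := ∑ i ∈ Finset.range (max N k), 1 / ((i : ℝ) + 1)) fun M hM => ?_
  have hup := hZ.sum_le_mul_measureReal_zeroIn hp hG (M := M) fun m hm =>
    sum_regenProb_le hB hi₀ hBi₀ m M
  have hsub : P.real (G ∩ zeroIn Z k M) ≤ P.real (G ∩ {ω | ∃ n, k ≤ n ∧ Z n ω = 0}) := by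
    refine measureReal_mono (Set.inter_subset_inter_right _ ?_)
    rintro ω ⟨n, h1, -, h2⟩
    exact ⟨n, h1, h2⟩
  have hlow : κ * (1 - B) * ∑ n ∈ Finset.Icc (max N k) M, 1 / ((n : ℝ) + 1) ≤
      ∑ n ∈ Finset.Icc k M, P.real (G ∩ {ω | Z n ω = 0}) := by
    rw [Finset.mul_sum]
    refine le_trans (Finset.sum_le_sum fun n hn => ?_)
      (Finset.sum_le_sum_of_subset_of_nonneg
        (Finset.Icc_subset_Icc_left (le_max_right N k)) fun n _ _ => measureReal_nonneg)
    have hn1 := (Finset.mem_Icc.1 hn).1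
    have hkn : k ≤ n := (le_max_right _ _).trans hn1
    rw [hZ.measureReal_inter_zero_eq hp hkn hG]
    calc κ * (1 - B) * (1 / ((n : ℝ) + 1)) = (1 - B) / (n + 1) * κ := by ring
      _ ≤ _ := mul_le_mul
        ((le_regenProb_zero hB hi₀ hBi₀ n).trans (regenProb_zero_le hp k n hkn))
        (hN n ((le_max_left _ _).trans hn1)).le hκ0 (regenProb_nonneg hp k n)
  have hico : Finset.Icc (max N k) M = Finset.Ico (max N k) (M + 1) := rfl
  rw [hico, Finset.sum_Ico_eq_sub _ (by omega)] at hlow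
  have hHn : 0 ≤ ∑ i ∈ Finset.range (M + 1), 1 / ((i : ℝ) + 1) :=
    Finset.sum_nonneg fun i _ => by positivity
  rw [mul_comm (P.real _)]
  exact hlow.trans (hup.trans (mul_le_mul_of_nonneg_left hsub hHn))

/-- A zero-one law: an event that keeps conditional probability at least `δ > 0` along a filtration
is almost sure. By Lévy's upward theorem the conditional probabilities tend to its indicator. -/
lemma ae_mem_of_forall_le_measureReal_inter {ℱ : Filtration ℕ mΩ} {E : Set Ω}
    (hE : MeasurableSet[⨆ n, ℱ n] E) {δ : ℝ} (hδ : 0 < δ)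
    (h : ∀ k G, MeasurableSet[ℱ k] G → δ * P.real G ≤ P.real (G ∩ E)) : ∀ᵐ ω ∂P, ω ∈ E := by
  have hle : ⨆ n, ℱ n ≤ mΩ := iSup_le fun n => ℱ.le n
  have hE' : MeasurableSet E := hle _ hE
  have hint : Integrable (E.indicator fun _ => (1 : ℝ)) P :=
    (integrable_const 1).indicator hE'
  have hge : ∀ k, ∀ᵐ ω ∂P, δ ≤ (P[E.indicator fun _ => (1 : ℝ) | ℱ k]) ω := by
    intro k
    have h1 : (fun _ => δ) ≤ᵐ[P.trim (ℱ.le k)] P[E.indicator fun _ => (1 : ℝ) | ℱ k] := by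
      refine ae_le_of_forall_setIntegral_le (integrable_const _)
        (integrable_condExp.trim (ℱ.le k) stronglyMeasurable_condExp) fun G hG _ => ?_
      rw [← setIntegral_trim (ℱ.le k) stronglyMeasurable_condExp hG,
        setIntegral_condExp (ℱ.le k) hint hG, setIntegral_indicator hE',
        ← setIntegral_trim (ℱ.le k) stronglyMeasurable_const hG]
      simpa [mul_comm] using h k G hG
    exact ae_le_of_ae_le_trim h1
  have hlim := tendsto_ae_condExp (μ := P) (ℱ := ℱ) (E.indicator fun _ => (1 : ℝ))
  rw [condExp_of_stronglyMeasurable hle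
    ((stronglyMeasurable_const).indicator hE) hint] at hlim
  filter_upwards [hlim, ae_all_iff.2 hge] with ω h1 h2
  by_contra hω
  have h3 := ge_of_tendsto' h1 h2
  rw [Set.indicator_of_notMem hω] at h3
  linarith

lemma IsBranchingWithImmigration.ae_infinite_regenerationTimes (hB : 0 ≤ B) (hB1 : B < 1)
    (hi₀ : 0 < i₀) (hBi₀ : B / (4 * i₀) < 1 / 2)
    (hZ : IsBranchingWithImmigration P (nearCritical B i₀) Z) :
    ∀ᵐ ω ∂P, (regenerationTimes Z ω).Infinite := by
  let ℱ : Filtration ℕ mΩ :=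
    ⟨pastSigma Z, fun _ _ h => pastSigma_mono h, fun n => pastSigma_le hZ.measurable n⟩
  let E : ℕ → Set Ω := fun m => {ω | ∃ n, m ≤ n ∧ Z n ω = 0}
  have hEm : ∀ m, MeasurableSet[⨆ n, ℱ n] (E m) := by
    intro m
    have : E m = ⋃ n, ⋃ (_ : m ≤ n), Z n ⁻¹' {0} := by ext ω; simp [E]
    rw [this]
    exact MeasurableSet.iUnion fun n => MeasurableSet.iUnion fun _ =>
      le_iSup (fun n => (ℱ n : MeasurableSpace Ω)) n _
        (measurable_pastSigma le_rfl (measurableSet_singleton 0))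
  have hEanti : Antitone E := fun a b hab ω ⟨n, h1, h2⟩ => ⟨n, hab.trans h1, h2⟩
  have hle : ⨆ n, ℱ n ≤ mΩ := iSup_le fun n => ℱ.le n
  have hae : ∀ᵐ ω ∂P, ω ∈ ⋂ m, E m := by
    refine ae_mem_of_forall_le_measureReal_inter (ℱ := ℱ) (MeasurableSet.iInter hEm)
      (sub_pos.2 hB1) fun k G hG => ?_
    have hGm : MeasurableSet G := ℱ.le k _ hG
    have hlim : Filter.Tendsto (fun m => P.real (G ∩ E m)) Filter.atTop
        (nhds (P.real (G ∩ ⋂ m, E m))) := by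
      rw [Set.inter_iInter]
      refine (ENNReal.tendsto_toReal (measure_ne_top _ _)).comp
        (tendsto_measure_iInter_atTop
          (fun m => (hGm.inter (hle _ (hEm m))).nullMeasurableSet)
          (fun a b hab => Set.inter_subset_inter_right _ (hEanti hab))
          ⟨0, measure_ne_top _ _⟩)
    refine ge_of_tendsto hlim ?_
    filter_upwards [Filter.eventually_ge_atTop k] with m hm
    exact hZ.le_measureReal_exists_zero hB hB1 hi₀ hBi₀ (pastSigma_mono hm _ hG)
  filter_upwards [hae] with ω hω
  refine Set.infinite_of_not_bddAbove ?_
  rintro ⟨b, hb⟩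
  obtain ⟨n, h1, h2⟩ := Set.mem_iInter.1 hω (b + 1)
  have := hb (show n ∈ regenerationTimes Z ω from h2)
  omega

end InfinitelyMany

/-! ### Extinction without immigration -/

/-- Without immigration `P (Y n = 0) = 1 - 1 / ∑ j ≤ n, A j`, which tends to `1` as soon as the
weights are not summable. -/
lemma IsBranching.ae_exists_eq_zero {Ω : Type*} [MeasurableSpace Ω] {P : Measure Ω}
    [IsProbabilityMeasure P] {p : ℕ → ℝ} {Y : ℕ → Ω → ℕ}
    (hp : ∀ i, 0 < p (i + 1) ∧ p (i + 1) < 1)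
    (hS : Filter.Tendsto (fun n => ∑ j ∈ Finset.Icc 0 n, oddsProd p j) Filter.atTop Filter.atTop)
    (hY : IsBranching P p Y) : ∀ᵐ ω ∂P, ∃ n, Y n ω = 0 := by
  have hzero : ∀ n, P.real {ω | Y n ω = 0} = 1 - 1 / ∑ j ∈ Finset.Icc 0 n, oddsProd p j := by
    intro n
    have h := measureReal_inter_zero_eq (e := 0) hp hY.measurable (by simpa using hY.step)
      (Nat.zero_le n) (G := Set.univ) MeasurableSet.univ
    rw [Set.univ_inter, setIntegral_univ, pow_zero, one_mul, oddsProd_zero,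
      integral_congr_ae (g := fun _ => 1 - 1 / ∑ j ∈ Finset.Icc 0 n, oddsProd p j)] at h
    · simpa using h
    · filter_upwards [hY.init] with ω hω
      simp [hω]
  have hmeas : MeasurableSet {ω | ∃ n, Y n ω = 0} := by
    have : {ω | ∃ n, Y n ω = 0} = ⋃ n, Y n ⁻¹' {0} := by ext ω; simp
    rw [this]
    exact MeasurableSet.iUnion fun n => hY.measurable n (measurableSet_singleton 0)
  have hlim : Filter.Tendsto (fun n => P.real {ω | Y n ω = 0}) Filter.atTop (nhds 1) := by
    simp_rw [hzero]
    simpa using (hS.const_div_atTop 1).const_sub 1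
  have hone : 1 ≤ P.real {ω | ∃ n, Y n ω = 0} :=
    le_of_tendsto' hlim fun n => measureReal_mono fun ω hω => ⟨n, hω⟩
  have : P {ω | ∃ n, Y n ω = 0} = 1 := by
    rw [← ofReal_measureReal, le_antisymm measureReal_le_one hone, ENNReal.ofReal_one]
  exact (prob_compl_eq_zero_iff hmeas).2 this

theorem theorem2 {Ω : Type*} [MeasurableSpace Ω] (P : Measure Ω) [IsProbabilityMeasure P]
    (B : ℝ) (hB : 0 ≤ B) (i₀ : ℝ) (hi₀ : 0 < i₀) (hBi₀ : B / (4 * i₀) < 1 / 2)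
    (Z : ℕ → Ω → ℕ) (hZ : IsBranchingWithImmigration P (nearCritical B i₀) Z) :
    (1 ≤ B → ∀ᵐ ω ∂P, (regenerationTimes Z ω).Finite) ∧
    (B < 1 → ∀ᵐ ω ∂P, (regenerationTimes Z ω).Infinite) ∧
    (B = 1 →
      (∀ (Ω' : Type*) [MeasurableSpace Ω'] (P' : Measure Ω') [IsProbabilityMeasure P']
        (Y : ℕ → Ω' → ℕ), IsBranching P' (nearCritical B i₀) Y →
          ∀ᵐ ω ∂P', ∃ n, Y n ω = 0) ∧
      ∀ᵐ ω ∂P, (regenerationTimes Z ω).Finite) :=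
  ⟨fun h => hZ.ae_finite_regenerationTimes h hi₀ hBi₀,
    fun h => hZ.ae_infinite_regenerationTimes hB h hi₀ hBi₀,
    fun h => ⟨fun _ _ _ _ _ hY => hY.ae_exists_eq_zero
      (nearCritical_pos_and_lt_one hB hi₀ hBi₀)
      (tendsto_sum_Icc_oddsProd_nearCritical hB h.le hi₀ 0),
      hZ.ae_finite_regenerationTimes h.ge hi₀ hBi₀⟩⟩
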